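/- Let $\mathbb K\in\{\mathbb R,\mathbb C\}$, let $X$ and $Y$ be separable Hilbert spaces over $\mathbb K$ (inner products linear in the first argument), and let $L:\mathcal D(L)\subset X\to Y$ be a linear operator, not necessarily bounded or closed. Consider one of the following two settings. *Discrete case.* Let $s\ge 1$, $\gamma_1,\dots,\gamma_s>0$ and $w_1,\dots,w_s\in\mathcal D(L)$. Let $S=\mathbb K^s$ with the inner product $(u,v)_S=\sum_{j=1}^s\gamma_j u_j\overline{v_j}$, and define $K:S\to X$ and $K^Y:S\to Y$ by $$Kf=\sum_{j=1}^s\gamma_j f_j w_j,\qquad K^Yf=LKf=\sum_{j=1}^s\gamma_j f_j Lw_j .$$ *Continuous case.* Let $d,m\ge 1$, let $\mathcal O\subset\mathbb R^d$ be open, $S=L^2(\mathcal O;\mathbb K^m)$ and $w_1,\dots,w_m\in L^2(\mathcal O;X)$. Assume that $w_j(t)\in\mathcal D(L)$ for a.e. $t\in\mathcal O$ and $Lw_j\in L^2(\mathcal O;Y)$ for each $j$, define $K:S\to X$ and $K^Y:S\to Y$ by $$Kf=\sum_{j=1}^m\int_{\mathcal O}f_j(t)w_j(t)\,dt,\qquad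 K^Yf=\sum_{j=1}^m\int_{\mathcal O}f_j(t)Lw_j(t)\,dt,$$ and assume that $Kf\in\mathcal D(L)$ and $LKf=K^Yf$ for all $f\in S$. Let $Kf=\sum_{k\ge1}\sigma_k(f,f_k)_S\varphi_k$ be a singular value decomposition of $K$, with singular values $\sigma_1\ge\sigma_2\ge\dots\ge0$ (repeated according to multiplicity) and singular vectors $f_k\in S$, $\varphi_k\in X$, where $\{f_k\}_{\sigma_k>0}$ and $\{\varphi_k\}_{\sigma_k>0}$ are orthonormal; put $\sigma_k=0$ for $k>s_X$, where $s_X=\operatorname{rank}(K)\in\{0,1,2,\dots\}\cup\{\infty\}$ is the number of positive singular values. If $\sigma_k>0$ then $\varphi_k\in\mathcal D(L)$. For each $r\ge1$ with $\sigma_r>0$ let $\Pi_r^Y:Y\to Y$ be a bounded, not necessarily orthogonal, projection onto $Y_r=\operatorname{span}\{L\varphi_1,\dots,L\varphi_r\}$. If $s_X=\infty$, assume that there is a constant $C$ with $\|\Pi_r^Y\|\le C$ for all $r$. In the following, "$\Pi_r^Yy\to y$ as $r$ increases" refers to the indices $r$ with $\sigma_r>0$, i.e. $1\le r\le s_X$: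 if $s_X=\infty$ it means convergence as $r\to\infty$, and if $1\le s_X<\infty$ it means that $\Pi_r^Yy=y$ for $r=s_X$. (If $s_X=0$ there is no such $r$ and nothing is claimed.) Then, in both cases: 1. If $y=K^Yg$ for some $g\in S$, then $\Pi_r^Yy\to y$ as $r$ increases, and for every $r\ge1$ with $\sigma_r>0$ $$\|\Pi_r^Yy-y\|_Y\le\sum_{k>r}\sigma_k\,|(g,f_k)_S|\,\|\Pi_r^YL\varphi_k-L\varphi_k\|_Y,$$ where the series on the right converges (terms with $\sigma_k=0$ are zero). 2. If all eigenvalues of $K^Y(K^Y)^*:Y\to Y$ (the POD eigenvalues of the data $\{Lw_j\}$) are nonzero, then $\Pi_r^Yy\to y$ as $r$ increases for every $y\in Y$. -/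

import Mathlib

open MeasureTheory Filter Topology
open scoped ENNReal InnerProductSpace

noncomputable section

namespace POD

/-! ### The weighted coefficient space of the discrete case -/

/-- The space `𝕜ˢ` with the weighted inner product `(u, v) = ∑ j, γ j * u j * conj (v j)`,
for positive weights `γ`. -/
def WeightedSpace (𝕜 : Type*) {s : ℕ} (_γ : Fin s → {c : ℝ // 0 < c}) : Type _ :=
  Fin s → 𝕜

section Weighted

variable {𝕜 : Type*} [RCLike 𝕜] {s : ℕ} (γ : Fin s → {c : ℝ // 0 < c})

instance WeightedSpace.instAddCommGroup : AddCommGroup (WeightedSpace 𝕜 γ) :=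
  inferInstanceAs (AddCommGroup (Fin s → 𝕜))

instance WeightedSpace.instModule : Module 𝕜 (WeightedSpace 𝕜 γ) :=
  inferInstanceAs (Module 𝕜 (Fin s → 𝕜))

instance WeightedSpace.instFiniteDimensional : FiniteDimensional 𝕜 (WeightedSpace 𝕜 γ) :=
  inferInstanceAs (FiniteDimensional 𝕜 (Fin s → 𝕜))

/-- The coordinates of an element of the weighted space. -/
def WeightedSpace.coord (j : Fin s) : WeightedSpace 𝕜 γ →ₗ[𝕜] 𝕜 :=
  (LinearMap.proj j : (Fin s → 𝕜) →ₗ[𝕜] 𝕜)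

theorem WeightedSpace.ext_coord {γ : Fin s → {c : ℝ // 0 < c}} {u v : WeightedSpace 𝕜 γ}
    (h : ∀ j, WeightedSpace.coord γ j u = WeightedSpace.coord γ j v) : u = v :=
  funext h

/-- The weighted inner product.  As everywhere in Mathlib the first argument is the conjugate
linear one: `inner 𝕜 v u` is the `(u, v)` of a convention that is linear in the first argument. -/
@[reducible] def WeightedSpace.core : InnerProductSpace.Core 𝕜 (WeightedSpace 𝕜 γ) where
  inner v u := ∑ j, ((γ j : ℝ) : 𝕜) * (WeightedSpace.coord γ j u *
    (starRingEnd 𝕜) (WeightedSpace.coord γ j v))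
  conj_inner_symm u v := by
    simp only [map_sum, map_mul, RCLike.conj_ofReal, RCLike.conj_conj]
    exact Finset.sum_congr rfl fun j _ => by ring
  re_inner_nonneg u := by
    simp only [map_sum, RCLike.mul_conj]
    refine Finset.sum_nonneg fun j _ => ?_
    have h := (γ j).2
    rw [← RCLike.ofReal_pow, ← RCLike.ofReal_mul, RCLike.ofReal_re]
    positivity
  add_left u v z := by
    rw [← Finset.sum_add_distrib]
    exact Finset.sum_congr rfl fun j _ => by simp only [map_add]; ring
  smul_left u v c := by
    rw [Finset.mul_sum]
    exact Finset.sum_congr rfl fun j _ => by simp only [map_smul, smul_eq_mul, map_mul]; ring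
  definite u hu := by
    have h1 : ∑ j, (γ j : ℝ) * ‖WeightedSpace.coord γ j u‖ ^ 2 = 0 := by
      have : ((∑ j, (γ j : ℝ) * ‖WeightedSpace.coord γ j u‖ ^ 2 : ℝ) : 𝕜) = 0 := by
        rw [← hu]
        push_cast
        exact Finset.sum_congr rfl fun j _ => by rw [RCLike.mul_conj]
      exact_mod_cast this
    rw [Finset.sum_eq_zero_iff_of_nonneg
      (fun j _ => mul_nonneg (γ j).2.le (sq_nonneg _))] at h1
    refine WeightedSpace.ext_coord fun j => ?_
    have h2 := h1 j (Finset.mem_univ j)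
    rcases mul_eq_zero.mp h2 with h3 | h3
    · exact absurd h3 (γ j).2.ne'
    · rw [map_zero]; exact norm_eq_zero.mp (pow_eq_zero_iff two_ne_zero |>.mp h3)

instance WeightedSpace.instNormedAddCommGroup : NormedAddCommGroup (WeightedSpace 𝕜 γ) :=
  (WeightedSpace.core (𝕜 := 𝕜) γ).toNormedAddCommGroup

instance WeightedSpace.instInnerProductSpace : InnerProductSpace 𝕜 (WeightedSpace 𝕜 γ) :=
  InnerProductSpace.ofCore (WeightedSpace.core γ).toCore

instance WeightedSpace.instCompleteSpace : CompleteSpace (WeightedSpace 𝕜 γ) :=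
  FiniteDimensional.complete 𝕜 (WeightedSpace 𝕜 γ)

theorem WeightedSpace.inner_def (v u : WeightedSpace 𝕜 γ) :
    inner 𝕜 v u = ∑ j, ((γ j : ℝ) : 𝕜) * (WeightedSpace.coord γ j u *
      (starRingEnd 𝕜) (WeightedSpace.coord γ j v)) :=
  rfl

/-! ### POD operators -/

/-- The discrete POD operator `K f = ∑ j, γ j * f j • w j` of the data `w`. -/
def discretePOD {Z : Type*} [NormedAddCommGroup Z] [InnerProductSpace 𝕜 Z] (w : Fin s → Z) :
    WeightedSpace 𝕜 γ →L[𝕜] Z :=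
  LinearMap.toContinuousLinearMap
    { toFun := fun f => ∑ j, (((γ j : ℝ) : 𝕜) * WeightedSpace.coord γ j f) • w j
      map_add' := fun f g => by
        simp only [map_add, mul_add, add_smul, Finset.sum_add_distrib]
      map_smul' := fun c f => by
        simp only [map_smul, smul_eq_mul, RingHom.id_apply, Finset.smul_sum, smul_smul]
        exact Finset.sum_congr rfl fun j _ => by congr 1; ring }

end Weighted

/-- The continuous POD operator `K f = ∑ j, ∫ f_j(t) w_j(t) dμ(t)` of the data
`w_j ∈ L²(μ; Z)`, defined on `S = L²(μ; 𝕜ᵐ)`. -/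
def continuousPOD {𝕜 : Type*} [RCLike 𝕜] {Ω : Type*} [MeasurableSpace Ω] (μ : Measure Ω)
    {m : ℕ} {Z : Type*} [NormedAddCommGroup Z] [InnerProductSpace 𝕜 Z] [CompleteSpace Z]
    [NormedSpace ℝ Z] [IsScalarTower ℝ 𝕜 Z] (w : Fin m → Lp Z 2 μ) :
    Lp (EuclideanSpace 𝕜 (Fin m)) 2 μ →L[𝕜] Z :=
  ContinuousLinearMap.copy
    (∑ j, (((ContinuousLinearMap.lsmul 𝕜 𝕜).lpPairing μ 2 2).flip (w j)) ∘L
      ((EuclideanSpace.proj j : EuclideanSpace 𝕜 (Fin m) →L[𝕜] 𝕜).compLpL 2 μ))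
    (fun f => ∑ j, ∫ t, (f t) j • w j t ∂μ)
    (by
      funext f
      simp only [FunLike.coe_sum, Finset.sum_apply, ContinuousLinearMap.coe_comp,
        Function.comp_apply, ContinuousLinearMap.flip_apply,
        ContinuousLinearMap.lpPairing_eq_integral, ContinuousLinearMap.lsmul_apply]
      refine Finset.sum_congr rfl fun j _ => integral_congr_ae ?_
      filter_upwards [ContinuousLinearMap.coeFn_compLpL (p := 2) (μ := μ)
        (EuclideanSpace.proj j : EuclideanSpace 𝕜 (Fin m) →L[𝕜] 𝕜) f] with t ht
      rw [ht]
      rfl)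

section General

variable {𝕜 : Type*} [RCLike 𝕜]
  {S : Type*} [NormedAddCommGroup S] [InnerProductSpace 𝕜 S]
  {X : Type*} [NormedAddCommGroup X] [InnerProductSpace 𝕜 X]
  {Y : Type*} [NormedAddCommGroup Y] [InnerProductSpace 𝕜 Y]

/-! ### Singular value decompositions -/

/-- `(σ_k, f_k, φ_k)`, `k = 1, 2, …`, is a singular value decomposition of `K`: the `σ_k` are
nonnegative and ordered decreasingly with repetitions, the singular vectors that belong to positive
singular values form orthonormal systems, and `K g = ∑ k, σ_k (g, f_k) φ_k` for all `g`.

If `K` has finite rank then `σ_k = 0` for all `k > rank K`.  Vectors `f_k`, `φ_k` with `σ_k = 0`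
(for instance those that complete the systems to orthonormal bases) do not contribute and are left
unrestricted. -/
structure IsSVD (K : S →L[𝕜] X) (σ : ℕ+ → ℝ) (f : ℕ+ → S) (φ : ℕ+ → X) : Prop where
  nonneg : ∀ k, 0 ≤ σ k
  antitone : Antitone σ
  orthonormal_left : Orthonormal 𝕜 (fun k : {k : ℕ+ // 0 < σ k} => f k)
  orthonormal_right : Orthonormal 𝕜 (fun k : {k : ℕ+ // 0 < σ k} => φ k)
  hasSum : ∀ g : S, HasSum (fun k : ℕ+ => ((σ k : 𝕜) * inner 𝕜 (f k) g) • φ k) (K g)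

/-- The number of positive singular values, `rank K`, as an element of `ℕ ∪ {∞}`. -/
def svRank (K : S →L[𝕜] X) : ℕ∞ :=
  Cardinal.toENat (LinearMap.rank (K : S →ₗ[𝕜] X))

/-- All eigenvalues of `K K^*` are nonzero. -/
def AllEigenvaluesNonzero [CompleteSpace S] [CompleteSpace Y] (K : S →L[𝕜] Y) : Prop :=
  ∀ c : 𝕜, Module.End.HasEigenvalue
    ((K ∘L ContinuousLinearMap.adjoint K : Y →L[𝕜] Y) : Module.End 𝕜 Y) c → c ≠ 0

/-- The value `L x` of a partially defined operator, and `0` if `x` is not in the domain. -/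
def app (L : X →ₗ.[𝕜] Y) (x : X) : Y :=
  open Classical in if h : x ∈ L.domain then L ⟨x, h⟩ else 0

theorem app_of_mem (L : X →ₗ.[𝕜] Y) {x : X} (h : x ∈ L.domain) : app L x = L ⟨x, h⟩ :=
  dif_pos h

theorem IsSVD.apply_left {K : S →L[𝕜] X} {σ : ℕ+ → ℝ} {f : ℕ+ → S} {φ : ℕ+ → X}
    (h : IsSVD K σ f φ) {k : ℕ+} (hk : 0 < σ k) : K (f k) = (σ k : 𝕜) • φ k := by
  have h1 := h.hasSum (f k)
  have h2 : ∀ l, l ≠ k → ((σ l : 𝕜) * inner 𝕜 (f l) (f k)) • φ l = 0 := by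
    intro l hl
    rcases (h.nonneg l).eq_or_lt with h0 | h0
    · simp [← h0]
    · have := h.orthonormal_left.2 (i := ⟨l, h0⟩) (j := ⟨k, hk⟩)
        (fun e => hl (congrArg Subtype.val e))
      simp only at this
      simp [this]
  have h3 := h1.unique (hasSum_single k h2)
  have h4 : ‖f k‖ = 1 := h.orthonormal_left.1 ⟨k, hk⟩
  rw [h3, inner_self_eq_norm_sq_to_K, h4]
  simp

/-- The POD modes with positive singular value lie in the domain of every operator whose domain
contains the range of `K`, so `app L (φ k)` is the genuine value `L φ_k` there. -/
theorem IsSVD.mem_domain {K : S →L[𝕜] X} {σ : ℕ+ → ℝ} {f : ℕ+ → S} {φ : ℕ+ → X}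
    (h : IsSVD K σ f φ) (L : X →ₗ.[𝕜] Y) (hK : ∀ g, K g ∈ L.domain) {k : ℕ+} (hk : 0 < σ k) :
    φ k ∈ L.domain := by
  have h0 : (σ k : 𝕜) ≠ 0 := by exact_mod_cast hk.ne'
  have h1 := L.domain.smul_mem ((σ k : 𝕜)⁻¹) (hK (f k))
  rwa [h.apply_left hk, smul_smul, inv_mul_cancel₀ h0, one_smul] at h1

/-- The indices `r = 1, 2, …` with `σ_r > 0`.  This is `{1, …, rank K}`, or all positive integers
if the rank is infinite.  Convergence of `a_r` to `l` "as `r` increases" is `Tendsto a atTop (𝓝 l)`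
on this index set; if the rank is finite and positive it means `a_r = l` for `r = rank K`. -/
abbrev Idx (σ : ℕ+ → ℝ) : Type := {r : ℕ+ // 0 < σ r}

/-- `Y_r = span {L φ_1, …, L φ_r}`. -/
def modeSpace (L : X →ₗ.[𝕜] Y) (φ : ℕ+ → X) (r : ℕ+) : Submodule 𝕜 Y :=
  Submodule.span 𝕜 ((fun k => app L (φ k)) '' Set.Iic r)

/-- `P` is a bounded, not necessarily orthogonal, projection onto `U`. -/
def IsProjectionOnto (P : Y →L[𝕜] Y) (U : Submodule 𝕜 Y) : Prop :=
  P ∘L P = P ∧ LinearMap.range (P : Y →ₗ[𝕜] Y) = U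

end General

end POD

end

/-! Since `KY = L K`, the vector `KY g` depends only on `K g`. So `g` may be replaced by its
orthogonal projection `p` onto the span of the `f_k` with `σ_k > 0`. Boundedness of `KY`, in place
of closedness of `L`, then gives `KY g = ∑ σ_k (g, f_k) L φ_k` (`IsSVD.hasSum_app`). Each `P r`
fixes `L φ_k` for `k ≤ r`. Applying `P r - I` to the expansion leaves only the tail, which is the
error bound. The tail converges absolutely because `σ_k ‖L φ_k‖ = ‖KY f_k‖` is square summable: `KY`
has finite rank in the discrete case and is Hilbert–Schmidt in the continuous one
(`summable_norm_sq_continuousPOD`). On each mode with `σ_k > 0` the projections are eventually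
exact, so uniform boundedness gives convergence on the closed span of these modes, which contains
the range of `KY`. If `KY KY^*` has no zero eigenvalue, that range is dense. -/

namespace POD

/-! ### Projections for an abstract pair `K`, `KY = L K`. -/

section Abstract

variable {𝕜 : Type*} [RCLike 𝕜]
  {S : Type*} [NormedAddCommGroup S] [InnerProductSpace 𝕜 S]
  {X : Type*} [NormedAddCommGroup X] [InnerProductSpace 𝕜 X]
  {Y : Type*} [NormedAddCommGroup Y] [InnerProductSpace 𝕜 Y]

/-- The series `∑ (f i, g) f i` of an orthonormal family converges. -/
theorem summable_inner_smul_of_orthonormal [CompleteSpace S] {ι : Type*} {v : ι → S}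
    (hv : Orthonormal 𝕜 v) (g : S) : Summable fun i => inner 𝕜 (v i) g • v i := by
  have h := hv.orthogonalFamily.summable_iff_norm_sq_summable (fun i => inner 𝕜 (v i) g)
  simp only [LinearIsometry.toSpanSingleton_apply] at h
  exact h.2 (hv.inner_products_summable g)

theorem summable_mul_of_summable_sq {ι : Type*} {a b : ι → ℝ}
    (ha : Summable fun i => a i ^ 2) (hb : Summable fun i => b i ^ 2)
    (ha0 : ∀ i, 0 ≤ a i) (hb0 : ∀ i, 0 ≤ b i) : Summable fun i => a i * b i :=
  Summable.of_nonneg_of_le (fun i => mul_nonneg (ha0 i) (hb0 i))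
    (fun i => by nlinarith [sq_nonneg (a i - b i), sq_nonneg (a i), sq_nonneg (b i)])
    (ha.add hb)

/-- If infinitely many singular values are positive then the rank is infinite. -/
theorem IsSVD.svRank_eq_top {K : S →L[𝕜] X} {σ : ℕ+ → ℝ} {f : ℕ+ → S} {φ : ℕ+ → X}
    (h : IsSVD K σ f φ) [Infinite (Idx σ)] : svRank K = ⊤ := by
  have hmem : ∀ k : Idx σ, φ k ∈ LinearMap.range (K : S →ₗ[𝕜] X) := fun k => by
    have h0 : (σ k : 𝕜) ≠ 0 := by exact_mod_cast k.2.ne'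
    refine ⟨(σ k : 𝕜)⁻¹ • f k, ?_⟩
    simp [h.apply_left k.2, smul_smul, inv_mul_cancel₀ h0]
  have hli : LinearIndependent 𝕜
      (fun k : Idx σ => (⟨φ k, hmem k⟩ : LinearMap.range (K : S →ₗ[𝕜] X))) := by
    refine LinearIndependent.of_comp (LinearMap.range (K : S →ₗ[𝕜] X)).subtype ?_
    exact h.orthonormal_right.linearIndependent
  rw [svRank, Cardinal.toENat_eq_top]
  exact hli.aleph0_le_rank

/-- Uniformly bounded operators that converge pointwise on the modes converge on the closed span. -/
theorem tendsto_of_mem_closure_span {ι : Type*} {l : Filter ι} {P : ι → Y →L[𝕜] Y} {C : ℝ}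
    (hC : ∀ r, ‖P r‖ ≤ C) {A : Set Y} (hA : ∀ y ∈ A, Tendsto (fun r => P r y) l (𝓝 y))
    {y : Y} (hy : y ∈ closure (Submodule.span 𝕜 A : Set Y)) :
    Tendsto (fun r => P r y) l (𝓝 y) := by
  have hspan : ∀ z ∈ Submodule.span 𝕜 A, Tendsto (fun r => P r z) l (𝓝 z) := by
    intro z hz
    induction hz using Submodule.span_induction with
    | mem x hx => exact hA x hx
    | zero => simpa using tendsto_const_nhds
    | add x y _ _ hx hy => simpa using hx.add hy
    | smul c x _ hx => simpa using hx.const_smul c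
  -- For empty `ι` the bound says nothing about the sign of `C`, but `l` is then the bottom filter.
  rcases isEmpty_or_nonempty ι with hι | ⟨⟨i⟩⟩
  · simp [Filter.filter_eq_bot_of_isEmpty l]
  have hC0 : 0 ≤ C := (norm_nonneg _).trans (hC i)
  rw [Metric.tendsto_nhds]
  intro ε hε
  obtain ⟨z, hz, hyz⟩ := Metric.mem_closure_iff.1 hy (ε / (C + 2)) (by positivity)
  filter_upwards [Metric.tendsto_nhds.1 (hspan z hz) (ε / (C + 2)) (by positivity)] with r hr
  have h1 : dist (P r y) (P r z) ≤ C * dist y z := by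
    rw [dist_eq_norm, dist_eq_norm, ← map_sub]
    exact (P r).le_of_opNorm_le (hC r) _
  have h2 : C * dist y z ≤ C * (ε / (C + 2)) := by gcongr
  -- The three legs of the path `P r y`, `P r z`, `z`, `y`.
  have h3 : C * (ε / (C + 2)) + ε / (C + 2) + ε / (C + 2) = ε := by field_simp; ring
  have h4 := dist_triangle4 (P r y) (P r z) z y
  rw [dist_comm z y] at h4
  linarith

theorem IsProjectionOnto.apply_of_mem {P : Y →L[𝕜] Y} {U : Submodule 𝕜 Y}
    (h : IsProjectionOnto P U) {y : Y} (hy : y ∈ U) : P y = y := by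
  rw [← h.2] at hy
  obtain ⟨z, rfl⟩ := hy
  exact DFunLike.congr_fun h.1 z

theorem app_mem_modeSpace (L : X →ₗ.[𝕜] Y) (φ : ℕ+ → X) {k r : ℕ+} (hkr : k ≤ r) :
    app L (φ k) ∈ modeSpace L φ r :=
  Submodule.subset_span ⟨k, hkr, rfl⟩

section Compatible

variable {L : X →ₗ.[𝕜] Y} {K : S →L[𝕜] X} {KY : S →L[𝕜] Y}
  {σ : ℕ+ → ℝ} {f : ℕ+ → S} {φ : ℕ+ → X}

/-- Apply `L` to `K f_k = σ_k φ_k`. This trades the unbounded `L` on modes for the bounded `KY` on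
singular vectors. -/
theorem IsSVD.smul_app (h : IsSVD K σ f φ) (hL : ∀ g, ∃ hg : K g ∈ L.domain, L ⟨K g, hg⟩ = KY g)
    {k : ℕ+} (hk : 0 < σ k) : (σ k : 𝕜) • app L (φ k) = KY (f k) := by
  have hφ := h.mem_domain L (fun g => (hL g).1) hk
  obtain ⟨hg, e⟩ := hL (f k)
  rw [← e, app_of_mem L hφ, ← L.map_smul]
  congr 1
  exact Subtype.ext (h.apply_left hk).symm

/-- The singular value expansion of `K` passes to `KY = L K`. -/
theorem IsSVD.hasSum_app [CompleteSpace S] (h : IsSVD K σ f φ)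
    (hL : ∀ g, ∃ hg : K g ∈ L.domain, L ⟨K g, hg⟩ = KY g) (g : S) :
    HasSum (fun k : ℕ+ => ((σ k : 𝕜) * inner 𝕜 (f k) g) • app L (φ k)) (KY g) := by
  obtain ⟨p, hp⟩ := summable_inner_smul_of_orthonormal h.orthonormal_left g
  have hzero : ∀ k : ℕ+, k ∉ {k : ℕ+ | 0 < σ k} → σ k = 0 := fun k hk =>
    le_antisymm (not_lt.1 hk) (h.nonneg k)
  -- Both sides are sums of the same series.
  have hK : K g = K p := by
    refine (h.hasSum g).unique ?_
    rw [← hasSum_subtype_iff_of_support_subset (s := {k : ℕ+ | 0 < σ k})]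
    · refine (hp.mapL K).congr_fun ?_
      intro k
      simp [h.apply_left k.2, smul_smul, mul_comm]
    · rw [Function.support_subset_iff']
      intro k hk
      simp [hzero k hk]
  have hKY : KY g = KY p := by
    obtain ⟨h1, e1⟩ := hL g
    obtain ⟨h2, e2⟩ := hL p
    rw [← e1, ← e2]
    congr 1
    exact Subtype.ext hK
  rw [hKY, ← hasSum_subtype_iff_of_support_subset (s := {k : ℕ+ | 0 < σ k})]
  · refine (hp.mapL KY).congr_fun ?_
    intro k
    simp [← h.smul_app hL k.2, smul_smul, mul_comm]
  · rw [Function.support_subset_iff']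
    intro k hk
    simp [hzero k hk]

/-- The terms of the expansion are absolutely summable if `KY` is square summable on the
singular vectors. -/
theorem IsSVD.summable_norm_app (h : IsSVD K σ f φ)
    (hL : ∀ g, ∃ hg : K g ∈ L.domain, L ⟨K g, hg⟩ = KY g)
    (hHS : Summable fun k : Idx σ => ‖KY (f k)‖ ^ 2) (g : S) :
    Summable fun k : ℕ+ => σ k * ‖inner 𝕜 (f k) g‖ * ‖app L (φ k)‖ := by
  -- Bessel's inequality for the coefficients of `g`, paired with the square summability of `‖KY
  -- f_k‖`.
  have h1 : Summable fun k : Idx σ => ‖inner 𝕜 (f k) g‖ * ‖KY (f k)‖ :=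
    summable_mul_of_summable_sq (h.orthonormal_left.inner_products_summable g) hHS
      (fun _ => norm_nonneg _) (fun _ => norm_nonneg _)
  rw [← (Subtype.val_injective (p := fun k => 0 < σ k)).summable_iff]
  · refine h1.congr fun k => ?_
    rw [← h.smul_app hL k.2, norm_smul, RCLike.norm_ofReal, abs_of_pos k.2]
    simp only [Function.comp_apply]
    ring
  · intro k hk
    have h0 : ¬ 0 < σ k := fun hk' => hk ⟨⟨k, hk'⟩, rfl⟩
    simp [le_antisymm (not_lt.1 h0) (h.nonneg k)]

/-- Either there are finitely many projections, or infinitely many positive singular values force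
infinite rank and the assumed bound applies. -/
theorem IsSVD.exists_norm_le (h : IsSVD K σ f φ) {P : Idx σ → Y →L[𝕜] Y}
    (hC : svRank K = ⊤ → ∃ C : ℝ, ∀ r, ‖P r‖ ≤ C) : ∃ C : ℝ, ∀ r, ‖P r‖ ≤ C := by
  rcases finite_or_infinite (Idx σ) with hfin | hinf
  · obtain ⟨C, hC⟩ := (Set.finite_range fun r => ‖P r‖).bddAbove
    exact ⟨C, fun r => hC ⟨r, rfl⟩⟩
  · exact hC h.svRank_eq_top

/-- The projections onto the mode spaces converge on the closure of the range of `KY`. -/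
theorem IsSVD.tendsto_projection [CompleteSpace S] (h : IsSVD K σ f φ)
    (hL : ∀ g, ∃ hg : K g ∈ L.domain, L ⟨K g, hg⟩ = KY g) {P : Idx σ → Y →L[𝕜] Y}
    (hP : ∀ r, IsProjectionOnto (P r) (modeSpace L φ r))
    (hC : svRank K = ⊤ → ∃ C : ℝ, ∀ r, ‖P r‖ ≤ C) {y : Y}
    (hy : y ∈ closure (Set.range KY)) : Tendsto (fun r => P r y) atTop (𝓝 y) := by
  obtain ⟨C, hC⟩ := h.exists_norm_le hC
  refine tendsto_of_mem_closure_span hC (A := (fun k : Idx σ => app L (φ k)) '' Set.univ) ?_ ?_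
  · rintro _ ⟨k, -, rfl⟩
    -- The projections are exact on this mode from `r = k` on. A finite index set needs no separate
    -- treatment.
    refine tendsto_const_nhds.congr' ?_
    filter_upwards [eventually_ge_atTop k] with r hr
    exact ((hP r).apply_of_mem (app_mem_modeSpace L φ hr)).symm
  · refine closure_minimal ?_ isClosed_closure hy
    rintro _ ⟨g, rfl⟩
    refine isClosed_closure.mem_of_tendsto (h.hasSum_app hL g) (Eventually.of_forall fun s => ?_)
    refine subset_closure (Submodule.sum_mem _ fun k _ => ?_)
    rcases (h.nonneg k).eq_or_lt with h0 | h0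
    · simp [← h0]
    · exact Submodule.smul_mem _ _ (Submodule.subset_span ⟨⟨k, h0⟩, trivial, rfl⟩)

/-- The error bound for a projection onto a mode space. -/
theorem IsSVD.norm_projection_sub_le [CompleteSpace S] (h : IsSVD K σ f φ)
    (hL : ∀ g, ∃ hg : K g ∈ L.domain, L ⟨K g, hg⟩ = KY g)
    (hHS : Summable fun k : Idx σ => ‖KY (f k)‖ ^ 2) {P : Y →L[𝕜] Y} {r : ℕ+}
    (hP : IsProjectionOnto P (modeSpace L φ r)) (g : S) :
    Summable (fun k : Set.Ioi r => σ k * ‖inner 𝕜 (f k) g‖ *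
        ‖P (app L (φ k)) - app L (φ k)‖) ∧
      ‖P (KY g) - KY g‖ ≤ ∑' k : Set.Ioi r, σ k * ‖inner 𝕜 (f k) g‖ *
        ‖P (app L (φ k)) - app L (φ k)‖ := by
  have hsum : Summable fun k : ℕ+ => σ k * ‖inner 𝕜 (f k) g‖ *
      ‖P (app L (φ k)) - app L (φ k)‖ := by
    refine Summable.of_nonneg_of_le (fun k => ?_) (fun k => ?_)
      ((h.summable_norm_app hL hHS g).mul_left ‖P - ContinuousLinearMap.id 𝕜 Y‖)
    · exact mul_nonneg (mul_nonneg (h.nonneg k) (norm_nonneg _)) (norm_nonneg _)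
    · have h1 : ‖P (app L (φ k)) - app L (φ k)‖ ≤
          ‖P - ContinuousLinearMap.id 𝕜 Y‖ * ‖app L (φ k)‖ :=
        (P - ContinuousLinearMap.id 𝕜 Y).le_opNorm _
      calc _ ≤ σ k * ‖inner 𝕜 (f k) g‖ *
            (‖P - ContinuousLinearMap.id 𝕜 Y‖ * ‖app L (φ k)‖) :=
            mul_le_mul_of_nonneg_left h1 (mul_nonneg (h.nonneg k) (norm_nonneg _))
        _ = _ := by ring
  have hsum' := hsum.subtype (Set.Ioi r)
  refine ⟨hsum', ?_⟩
  have h2 := (h.hasSum_app hL g).mapL (P - ContinuousLinearMap.id 𝕜 Y)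
  -- `P - I` annihilates the modes with `k ≤ r`, so the sum lives on `k > r`.
  rw [← hasSum_subtype_iff_of_support_subset (s := Set.Ioi r)] at h2
  · refine h2.norm_le_of_bounded hsum'.hasSum fun k => ?_
    simp [norm_smul, abs_of_nonneg (h.nonneg _)]
  · rw [Function.support_subset_iff']
    intro k hk
    simp [hP.apply_of_mem (app_mem_modeSpace L φ (not_lt.1 hk))]

/-- A nonzero vector orthogonal to the range lies in the kernel of `KY^*`, hence is an eigenvector
of `KY KY^*` for the eigenvalue 0. -/
theorem dense_range_of_allEigenvaluesNonzero [CompleteSpace S] [CompleteSpace Y]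
    (h : AllEigenvaluesNonzero KY) (y : Y) : y ∈ closure (Set.range KY) := by
  have hker : KY.rangeᗮ = ⊥ := by
    rw [ContinuousLinearMap.orthogonal_range, Submodule.eq_bot_iff]
    intro z hz
    by_contra hz0
    refine h 0 (Module.End.hasEigenvalue_of_hasEigenvector (x := z) ⟨?_, hz0⟩) rfl
    rw [Module.End.mem_eigenspace_iff]
    have : ContinuousLinearMap.adjoint KY z = 0 := hz
    simp [this]
  have := (Submodule.topologicalClosure_eq_top_iff (K := KY.range)).2 hker
  have h2 : y ∈ KY.range.topologicalClosure := by rw [this]; trivial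
  exact h2

/-- Convergence and error bound for POD projections, for a square summable operator `KY = L K`. -/
theorem IsSVD.projection_convergence [CompleteSpace S] [CompleteSpace Y] (h : IsSVD K σ f φ)
    (hL : ∀ g, ∃ hg : K g ∈ L.domain, L ⟨K g, hg⟩ = KY g)
    (hHS : Summable fun k : Idx σ => ‖KY (f k)‖ ^ 2) (P : Idx σ → Y →L[𝕜] Y)
    (hP : ∀ r, IsProjectionOnto (P r) (modeSpace L φ r))
    (hC : svRank K = ⊤ → ∃ C : ℝ, ∀ r, ‖P r‖ ≤ C) :
    (∀ g, Tendsto (fun r => P r (KY g)) atTop (𝓝 (KY g)) ∧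
      ∀ r : Idx σ,
        Summable (fun k : Set.Ioi r.1 => σ k * ‖inner 𝕜 (f k) g‖ *
          ‖P r (app L (φ k)) - app L (φ k)‖) ∧
        ‖P r (KY g) - KY g‖ ≤ ∑' k : Set.Ioi r.1, σ k * ‖inner 𝕜 (f k) g‖ *
          ‖P r (app L (φ k)) - app L (φ k)‖) ∧
    (AllEigenvaluesNonzero KY → ∀ y : Y, Tendsto (fun r => P r y) atTop (𝓝 y)) :=
  ⟨fun g => ⟨h.tendsto_projection hL hP hC (subset_closure ⟨g, rfl⟩),
    fun r => h.norm_projection_sub_le hL hHS (hP r) g⟩,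
    fun hE y => h.tendsto_projection hL hP hC (dense_range_of_allEigenvaluesNonzero hE y)⟩

end Compatible

end Abstract

/-! ### Discrete data. -/

section Discrete

variable {𝕜 : Type*} [RCLike 𝕜] {s : ℕ} (γ : Fin s → {c : ℝ // 0 < c})
  {X : Type*} [NormedAddCommGroup X] [InnerProductSpace 𝕜 X]
  {Y : Type*} [NormedAddCommGroup Y] [InnerProductSpace 𝕜 Y]

theorem discretePOD_apply (w : Fin s → X) (f : WeightedSpace 𝕜 γ) :
    discretePOD γ w f = ∑ j, (((γ j : ℝ) : 𝕜) * WeightedSpace.coord γ j f) • w j :=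
  rfl

/-- For finite sums, linearity of `L` alone yields the compatibility that is assumed in the
continuous case. -/
theorem map_discretePOD (L : X →ₗ.[𝕜] Y) (w : Fin s → X) (hw : ∀ j, w j ∈ L.domain)
    (g : WeightedSpace 𝕜 γ) : ∃ hg : discretePOD γ w g ∈ L.domain,
      L ⟨discretePOD γ w g, hg⟩ = discretePOD γ (fun j => L ⟨w j, hw j⟩) g := by
  have hg : discretePOD γ w g ∈ L.domain := by
    rw [discretePOD_apply]
    exact Submodule.sum_mem _ fun j _ => Submodule.smul_mem _ _ (hw j)
  refine ⟨hg, ?_⟩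
  have e : (⟨discretePOD γ w g, hg⟩ : L.domain) =
      ∑ j, (((γ j : ℝ) : 𝕜) * WeightedSpace.coord γ j g) • (⟨w j, hw j⟩ : L.domain) := by
    apply Subtype.ext
    simp [discretePOD_apply]
  rw [e, discretePOD_apply]
  exact (map_sum L.toFun _ _).trans (Finset.sum_congr rfl fun j _ => L.map_smul _ _)

end Discrete

/-! ### Continuous data: the Hilbert–Schmidt property. -/

section Continuous

variable {𝕜 : Type*} [RCLike 𝕜] {Ω : Type*} [MeasurableSpace Ω] {μ : Measure Ω} {m : ℕ}
  {Y : Type*} [NormedAddCommGroup Y] [InnerProductSpace 𝕜 Y]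

/-- The function `t ↦ (conj (e_j(t)) y)_j`. -/
noncomputable def conjTensor (e : Lp (EuclideanSpace 𝕜 (Fin m)) 2 μ) (y : Y) (t : Ω) :
    PiLp 2 (fun _ : Fin m => Y) :=
  WithLp.toLp 2 fun j => (starRingEnd 𝕜) (e t j) • y

theorem memLp_conjTensor (e : Lp (EuclideanSpace 𝕜 (Fin m)) 2 μ) (y : Y) :
    MemLp (conjTensor e y) 2 μ := by
  refine MemLp.of_eval_piLp fun j => ?_
  have h := (Lp.memLp e).eval_piLp j
  refine h.of_le_mul (c := ‖y‖) ?_ (Eventually.of_forall fun t => ?_)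
  · exact (RCLike.continuous_conj.comp_aestronglyMeasurable h.1).smul_const y
  · simp [conjTensor, norm_smul, mul_comm]

/-- The inner product factors, so tensors of orthonormal `e_i` with arbitrary unit vectors are
orthonormal. -/
theorem inner_conjTensor (e e' : Lp (EuclideanSpace 𝕜 (Fin m)) 2 μ) (y y' : Y) :
    inner 𝕜 ((memLp_conjTensor e y).toLp) ((memLp_conjTensor e' y').toLp) =
      inner 𝕜 e' e * inner 𝕜 y y' := by
  rw [L2.inner_def, L2.inner_def, ← integral_mul_const]
  refine integral_congr_ae ?_
  filter_upwards [(memLp_conjTensor e y).coeFn_toLp, (memLp_conjTensor e' y').coeFn_toLp]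
    with t h1 h2
  rw [h1, h2]
  simp only [conjTensor, PiLp.inner_apply, inner_smul_left, inner_smul_right, RCLike.conj_conj,
    RCLike.inner_apply, Finset.sum_mul]
  exact Finset.sum_congr rfl fun j _ => by ring

/-- The data `w_1, …, w_m` as a single function with values in `Yᵐ`. -/
theorem memLp_data (w : Fin m → Lp Y 2 μ) :
    MemLp (fun t => (WithLp.toLp 2 fun j => w j t : PiLp 2 (fun _ : Fin m => Y))) 2 μ :=
  MemLp.of_eval_piLp fun j => Lp.memLp (w j)

variable [CompleteSpace Y] [NormedSpace ℝ Y] [IsScalarTower ℝ 𝕜 Y]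

theorem continuousPOD_apply (w : Fin m → Lp Y 2 μ) (f : Lp (EuclideanSpace 𝕜 (Fin m)) 2 μ) :
    continuousPOD μ w f = ∑ j, ∫ t, (f t) j • w j t ∂μ :=
  rfl

/-- Moving `y` inside the integral makes each matrix coefficient of the POD operator a coefficient
of one fixed vector, the data, so that Bessel's inequality can be used. -/
theorem inner_conjTensor_data (w : Fin m → Lp Y 2 μ) (e : Lp (EuclideanSpace 𝕜 (Fin m)) 2 μ)
    (y : Y) : inner 𝕜 ((memLp_conjTensor e y).toLp) ((memLp_data w).toLp) =
      inner 𝕜 y (continuousPOD μ w e) := by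
  have hint : ∀ j, Integrable (fun t => e t j • w j t) μ := fun j => by
    rw [← memLp_one_iff_integrable]
    exact (Lp.memLp (w j)).smul ((Lp.memLp e).eval_piLp j)
  rw [L2.inner_def, continuousPOD_apply, inner_sum]
  simp_rw [← integral_inner (𝕜 := 𝕜) (hint _) y]
  rw [← integral_finsetSum _ fun j _ => (hint j).const_inner y]
  refine integral_congr_ae ?_
  filter_upwards [(memLp_conjTensor e y).coeFn_toLp, (memLp_data w).coeFn_toLp] with t h1 h2
  rw [h1, h2]
  simp [conjTensor, PiLp.inner_apply, inner_smul_left, inner_smul_right]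

/-- The continuous POD operator is a Hilbert–Schmidt operator. -/
theorem summable_norm_sq_continuousPOD (w : Fin m → Lp Y 2 μ) {ι : Type*}
    {e : ι → Lp (EuclideanSpace 𝕜 (Fin m)) 2 μ} (he : Orthonormal 𝕜 e) :
    Summable fun i => ‖continuousPOD μ w (e i)‖ ^ 2 := by
  classical
  set T := continuousPOD (𝕜 := 𝕜) μ w
  -- Only for these indices can `T (e i)` be normalised to a unit vector `u i`; the others
  -- contribute zero.
  set A : Set ι := {i | T (e i) ≠ 0}
  have hunit : ∀ i : A, ∃ y : Y, ‖y‖ = 1 ∧ ‖inner 𝕜 y (T (e i))‖ = ‖T (e i)‖ := fun i => by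
    have hi : ‖T (e i)‖ ≠ 0 := norm_ne_zero_iff.2 i.2
    refine ⟨((‖T (e i)‖ : 𝕜)⁻¹) • T (e i), ?_, ?_⟩
    · rw [norm_smul, norm_inv, RCLike.norm_ofReal, abs_norm, inv_mul_cancel₀ hi]
    · rw [inner_smul_left, inner_self_eq_norm_sq_to_K, norm_mul, RCLike.norm_conj, norm_inv,
        norm_pow, RCLike.norm_ofReal, abs_norm]
      field_simp
  choose u hu1 hu2 using hunit
  have hon : Orthonormal 𝕜 fun i : A => (memLp_conjTensor (e i) (u i)).toLp := by
    rw [orthonormal_iff_ite]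
    intro i j
    rw [inner_conjTensor, orthonormal_iff_ite.1 he]
    by_cases hij : i = j
    · subst hij
      simp [inner_self_eq_norm_sq_to_K, hu1]
    · have : (j : ι) ≠ i := fun h => hij (Subtype.ext h.symm)
      simp [hij, this]
  have h := hon.inner_products_summable ((memLp_data w).toLp)
  rw [← (Subtype.val_injective (p := fun i => i ∈ A)).summable_iff]
  · refine h.congr fun i => ?_
    rw [inner_conjTensor_data, hu2]
    rfl
  · intro i hi
    have : T (e i) = 0 := not_not.1 fun h0 => hi ⟨⟨i, h0⟩, rfl⟩
    simp [this]

end Continuous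

end POD

theorem mainTheorem3 {𝕜 : Type*} [RCLike 𝕜]
    {X : Type*} [NormedAddCommGroup X] [InnerProductSpace 𝕜 X] [CompleteSpace X]
    [TopologicalSpace.SeparableSpace X] [NormedSpace ℝ X] [IsScalarTower ℝ 𝕜 X]
    {Y : Type*} [NormedAddCommGroup Y] [InnerProductSpace 𝕜 Y] [CompleteSpace Y]
    [TopologicalSpace.SeparableSpace Y] [NormedSpace ℝ Y] [IsScalarTower ℝ 𝕜 Y]
    (L : X →ₗ.[𝕜] Y) :
    -- the discrete case
    (∀ (s : ℕ) (_ : 0 < s) (γ : Fin s → {c : ℝ // 0 < c}) (w : Fin s → X)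
      (hw : ∀ j, w j ∈ L.domain)
      (K : POD.WeightedSpace 𝕜 γ →L[𝕜] X) (_ : K = POD.discretePOD γ w)
      (KY : POD.WeightedSpace 𝕜 γ →L[𝕜] Y)
      (_ : KY = POD.discretePOD γ (fun j => L ⟨w j, hw j⟩))
      (σ : ℕ+ → ℝ) (f : ℕ+ → POD.WeightedSpace 𝕜 γ) (φ : ℕ+ → X) (_ : POD.IsSVD K σ f φ)
      (P : POD.Idx σ → Y →L[𝕜] Y)
      (_ : ∀ r, POD.IsProjectionOnto (P r) (POD.modeSpace L φ r))
      (_ : POD.svRank K = ⊤ → ∃ C : ℝ, ∀ r, ‖P r‖ ≤ C),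
      (∀ g, Tendsto (fun r => P r (KY g)) atTop (𝓝 (KY g)) ∧
        ∀ r : POD.Idx σ,
          Summable (fun k : Set.Ioi r.1 => σ k * ‖inner 𝕜 (f k) g‖ *
            ‖P r (POD.app L (φ k)) - POD.app L (φ k)‖) ∧
          ‖P r (KY g) - KY g‖ ≤ ∑' k : Set.Ioi r.1, σ k * ‖inner 𝕜 (f k) g‖ *
            ‖P r (POD.app L (φ k)) - POD.app L (φ k)‖) ∧
      (POD.AllEigenvaluesNonzero KY → ∀ y : Y, Tendsto (fun r => P r y) atTop (𝓝 y))) ∧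
    -- the continuous case
    (∀ (d m : ℕ) (_ : 0 < d) (_ : 0 < m) (O : Set (EuclideanSpace ℝ (Fin d))) (_ : IsOpen O)
      (w : Fin m → Lp X 2 (volume.restrict O)) (Lw : Fin m → Lp Y 2 (volume.restrict O))
      (_ : ∀ j, ∀ᵐ t ∂(volume.restrict O), ∃ h : w j t ∈ L.domain, L ⟨w j t, h⟩ = Lw j t)
      (K : Lp (EuclideanSpace 𝕜 (Fin m)) 2 (volume.restrict O) →L[𝕜] X)
      (_ : K = POD.continuousPOD (volume.restrict O) w)
      (KY : Lp (EuclideanSpace 𝕜 (Fin m)) 2 (volume.restrict O) →L[𝕜] Y)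
      (_ : KY = POD.continuousPOD (volume.restrict O) Lw)
      (_ : ∀ g, ∃ h : K g ∈ L.domain, L ⟨K g, h⟩ = KY g)
      (σ : ℕ+ → ℝ) (f : ℕ+ → Lp (EuclideanSpace 𝕜 (Fin m)) 2 (volume.restrict O))
      (φ : ℕ+ → X) (_ : POD.IsSVD K σ f φ)
      (P : POD.Idx σ → Y →L[𝕜] Y)
      (_ : ∀ r, POD.IsProjectionOnto (P r) (POD.modeSpace L φ r))
      (_ : POD.svRank K = ⊤ → ∃ C : ℝ, ∀ r, ‖P r‖ ≤ C),
      (∀ g, Tendsto (fun r => P r (KY g)) atTop (𝓝 (KY g)) ∧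
        ∀ r : POD.Idx σ,
          Summable (fun k : Set.Ioi r.1 => σ k * ‖inner 𝕜 (f k) g‖ *
            ‖P r (POD.app L (φ k)) - POD.app L (φ k)‖) ∧
          ‖P r (KY g) - KY g‖ ≤ ∑' k : Set.Ioi r.1, σ k * ‖inner 𝕜 (f k) g‖ *
            ‖P r (POD.app L (φ k)) - POD.app L (φ k)‖) ∧
      (POD.AllEigenvaluesNonzero KY → ∀ y : Y, Tendsto (fun r => P r y) atTop (𝓝 y))) := by
  refine ⟨?_, ?_⟩
  · rintro s - γ w hw _ rfl _ rfl σ f φ hsvd P hP hC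
    -- Orthonormal vectors in a finite-dimensional space are finitely many, so square summability is
    -- trivial.
    have : Finite (POD.Idx σ) := hsvd.orthonormal_left.linearIndependent.finite
    exact hsvd.projection_convergence (POD.map_discretePOD γ L w hw) Summable.of_finite P hP hC
  · rintro d m - - O - w Lw - _ rfl _ rfl hL σ f φ hsvd P hP hC
    exact hsvd.projection_convergence hL
      (POD.summable_norm_sq_continuousPOD Lw hsvd.orthonormal_left) P hP hC
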